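/- Let $p$ be an odd prime, let $\left(\frac{\cdot}{p}\right)$ denote the Legendre symbol, and let $E_n(x)$ ($n=0,1,2,\ldots$) denote the Euler polynomials, defined by $$\frac{2e^{xz}}{e^z+1}=\sum_{n=0}^{\infty}E_n(x)\frac{z^n}{n!}.$$ For rational numbers $a,b$, the congruence $a\equiv b\pmod{p^2}$ means that $a$ and $b$ are $p$-adic integers and $a-b\in p^2\mathbb{Z}_p$. Then $$\sum_{k=0}^{p-1}\frac{\binom{4k}{2k}}{(2k+1)16^k}\equiv\left(\frac{2}{p}\right)+\frac34\,p\,E_{p-2}\left(\frac14\right)\pmod{p^2}.$$ If moreover $p>3$, then $$\sum_{k=0}^{p-1}\frac{\binom{3k}{k}}{2k+1}\left(\frac{4}{27}\right)^k\equiv1+\frac43\,p\,E_{p-2}\left(\frac13\right)\pmod{p^2}$$ and $$\sum_{k=0}^{p-1}\frac{\binom{6k}{3k}\binom{3k}{k}}{(2k+1)108^k\binom{2k}{k}}\equiv\left(\frac{3}{p}\right)+\frac{5}{12}\,p\,E_{p-2}\left(\frac16\right)\pmod{p^2}.$$ -/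

import Mathlib

/-- The Euler polynomial `E_n(x)`, as an element of `ℚ[x]`: it is `n!` times the coefficient of
`z ^ n` in the power series `2 * e ^ (x * z) / (e ^ z + 1)`, taken here as a formal power series
in `z` over `ℚ[x]`. The factor `2 / (e ^ z + 1)` is computed in `ℚ⟦z⟧`, where `e ^ z + 1` is
invertible since its constant coefficient is `2`. -/
noncomputable def eulerPolynomial (n : ℕ) : Polynomial ℚ :=
  (Nat.factorial n : Polynomial ℚ) *
    PowerSeries.coeff n
      (PowerSeries.map Polynomial.C (2 * (PowerSeries.exp ℚ + 1)⁻¹) *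
        PowerSeries.rescale Polynomial.X (PowerSeries.exp (Polynomial ℚ)))

/-- `PadicCongr p r a b` says that the rational numbers `a` and `b` are `p`-adic integers
and that `a ≡ b (mod p ^ r)` in the ring `ℤ_[p]`. -/
def PadicCongr (p : ℕ) [Fact p.Prime] (r : ℕ) (a b : ℚ) : Prop :=
  ∃ u v : ℤ_[p], (u : ℚ_[p]) = (a : ℚ_[p]) ∧ (v : ℚ_[p]) = (b : ℚ_[p]) ∧
    (p : ℤ_[p]) ^ r ∣ u - v

section

open Finset

/-! The summands are the terms of ₂F₁(-a, a + 1; 3/2; 1) at a = -1/4, -1/3, -1/6. Let F(x) be 2x + 1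
times the series cut off after p terms (`hypSum p x`). Then F(x) + F(x - 1) has a product formula,
and F(-1 - x) = -F(x). Write a = pt + n with 0 ≤ n < p and t p-integral. Modulo p², F(pt) is a
quadratic in t, fixed by its values at 0, 1 and -1 (`hypSum_prime_mul_ratCong`). For 0 < m < p the
product formula gives F(pt + m) + F(pt + m - 1) ≡ 4t(t + 1)p·m^(p-2) (`mul_hypShiftTerm_ratCong`).
This is the recurrence of -2t(t + 1)p·E_{p-2}(-m), so F and the Euler term advance together in n; at
n = 0 they agree because p·E_{p-2}(0) ≡ 1 - 4^(p-1). Dividing by 2a + 1 gives the three congruences.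
-/

/-- The subring of `p`-integral rational numbers. -/
noncomputable def padicIntegralRat (p : ℕ) [Fact p.Prime] : Subring ℚ :=
  (PadicInt.subring p).comap (Rat.castHom ℚ_[p])

/-! ### Congruences between rationals modulo powers of p. -/

section Congruence

variable {p : ℕ} [Fact p.Prime]

theorem mem_padicIntegralRat {x : ℚ} : x ∈ padicIntegralRat p ↔ ‖(x : ℚ_[p])‖ ≤ 1 := Iff.rfl

theorem inv_natCast_mem_padicIntegralRat {n : ℕ} (h : ¬ p ∣ n) :
    (n : ℚ)⁻¹ ∈ padicIntegralRat p := by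
  rw [mem_padicIntegralRat]
  have : ‖(n : ℚ_[p])‖ = 1 := by
    rw [Padic.norm_natCast_eq_one_iff]
    exact ((Fact.out : p.Prime).coprime_iff_not_dvd).2 h
  push_cast
  rw [norm_inv, this, inv_one]

/-- Congruence of rational numbers modulo `p ^ r` up to `p`-integral multiples. -/
def RatCong (p : ℕ) [Fact p.Prime] (r : ℕ) (x y : ℚ) : Prop :=
  ∃ z ∈ padicIntegralRat p, x - y = (p : ℚ) ^ r * z

/-- `RatCong` constrains only the difference, so integrality of one side must be supplied. -/
theorem PadicCongr.of_ratCong {r : ℕ} {x y : ℚ} (hy : y ∈ padicIntegralRat p)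
    (h : RatCong p r x y) : PadicCongr p r x y := by
  obtain ⟨z, hz, e⟩ := h
  refine ⟨⟨(y : ℚ_[p]), hy⟩ + (p : ℤ_[p]) ^ r * ⟨(z : ℚ_[p]), hz⟩, ⟨(y : ℚ_[p]), hy⟩, ?_, rfl,
    ⟨(z : ℚ_[p]), hz⟩, add_sub_cancel_left _ _⟩
  obtain rfl : x = y + (p : ℚ) ^ r * z := by linarith
  push_cast
  rfl

namespace RatCong

variable {r : ℕ} {x y z w : ℚ}

theorem refl (x : ℚ) : RatCong p r x x := ⟨0, zero_mem _, by ring⟩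

theorem of_eq (h : x = y) : RatCong p r x y := h ▸ refl x

theorem symm (h : RatCong p r x y) : RatCong p r y x := by
  obtain ⟨u, hu, e⟩ := h
  exact ⟨-u, neg_mem hu, by linear_combination -e⟩

theorem trans (h : RatCong p r x y) (h' : RatCong p r y z) : RatCong p r x z := by
  obtain ⟨u, hu, e⟩ := h
  obtain ⟨v, hv, e'⟩ := h'
  exact ⟨u + v, add_mem hu hv, by linear_combination e + e'⟩

theorem add (h : RatCong p r x y) (h' : RatCong p r z w) : RatCong p r (x + z) (y + w) := by
  obtain ⟨u, hu, e⟩ := h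
  obtain ⟨v, hv, e'⟩ := h'
  exact ⟨u + v, add_mem hu hv, by linear_combination e + e'⟩

theorem neg (h : RatCong p r x y) : RatCong p r (-x) (-y) := by
  obtain ⟨u, hu, e⟩ := h
  exact ⟨-u, neg_mem hu, by linear_combination -e⟩

theorem sub (h : RatCong p r x y) (h' : RatCong p r z w) : RatCong p r (x - z) (y - w) := by
  simpa only [sub_eq_add_neg] using h.add h'.neg

theorem mul_left (hz : z ∈ padicIntegralRat p) (h : RatCong p r x y) :
    RatCong p r (z * x) (z * y) := by
  obtain ⟨u, hu, e⟩ := h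
  exact ⟨z * u, mul_mem hz hu, by linear_combination z * e⟩

theorem mul (hy : y ∈ padicIntegralRat p) (hz : z ∈ padicIntegralRat p)
    (h : RatCong p r x y) (h' : RatCong p r z w) : RatCong p r (x * z) (y * w) := by
  obtain ⟨u, hu, e⟩ := h
  obtain ⟨v, hv, e'⟩ := h'
  exact ⟨u * z + y * v, add_mem (mul_mem hu hz) (mul_mem hy hv), by
    linear_combination z * e + y * e'⟩

theorem mem_of_mem (hy : y ∈ padicIntegralRat p) (h : RatCong p r x y) :
    x ∈ padicIntegralRat p := by
  obtain ⟨u, hu, e⟩ := h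
  rw [show x = y + (p : ℚ) ^ r * u by linarith]
  exact add_mem hy (mul_mem (pow_mem (natCast_mem _ p) r) hu)

theorem prime_mul (h : RatCong p r x y) : RatCong p (r + 1) (p * x) (p * y) := by
  obtain ⟨u, hu, e⟩ := h
  exact ⟨u, hu, by rw [pow_succ]; linear_combination p * e⟩

theorem sum {ι : Type*} {s : Finset ι} {f g : ι → ℚ} (h : ∀ i ∈ s, RatCong p r (f i) (g i)) :
    RatCong p r (∑ i ∈ s, f i) (∑ i ∈ s, g i) := by
  classical
  induction s using Finset.induction_on with
  | empty => exact refl _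
  | insert a s ha ih =>
    rw [sum_insert ha, sum_insert ha]
    exact (h a (mem_insert_self a s)).add (ih fun i hi => h i (mem_insert_of_mem hi))

theorem prod {ι : Type*} {s : Finset ι} {f g : ι → ℚ} (hg : ∀ i ∈ s, g i ∈ padicIntegralRat p)
    (h : ∀ i ∈ s, RatCong p r (f i) (g i)) :
    RatCong p r (∏ i ∈ s, f i) (∏ i ∈ s, g i) := by
  classical
  induction s using Finset.induction_on with
  | empty => exact refl _
  | insert a s ha ih =>
    rw [prod_insert ha, prod_insert ha]
    have hs : ∀ i ∈ s, RatCong p r (f i) (g i) := fun i hi => h i (mem_insert_of_mem hi)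
    have hg' : ∀ i ∈ s, g i ∈ padicIntegralRat p := fun i hi => hg i (mem_insert_of_mem hi)
    exact mul (hg a (mem_insert_self a s)) (prod_mem fun i hi => (hs i hi).mem_of_mem (hg' i hi))
      (h a (mem_insert_self a s)) (ih hg' hs)

theorem pow (hy : y ∈ padicIntegralRat p) (h : RatCong p r x y) (n : ℕ) :
    RatCong p r (x ^ n) (y ^ n) := by
  simpa using prod (s := range n) (f := fun _ => x) (g := fun _ => y) (fun _ _ => hy) fun _ _ => h

theorem of_intCast_zmod {a b : ℤ} (h : (a : ZMod p) = b) : RatCong p 1 (a : ℚ) b := by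
  obtain ⟨c, hc⟩ := (ZMod.intCast_eq_intCast_iff_dvd_sub b a p).1 h.symm
  exact ⟨c, intCast_mem _ c, by rw [pow_one]; exact_mod_cast hc⟩

end RatCong

/-- Below 2p only the factor p itself is divisible by p. This controls the denominators (2k + 1)!
with k < p. -/
theorem prime_div_factorial_mem_padicIntegralRat {n : ℕ} (hn : n < 2 * p) :
    (p : ℚ) / (n.factorial : ℚ) ∈ padicIntegralRat p := by
  have hp : p.Prime := Fact.out
  have hp0 : (p : ℚ) ≠ 0 := by exact_mod_cast hp.ne_zero
  induction n with
  | zero => simp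
  | succ n ih =>
    by_cases h : n + 1 = p
    · have : ¬ p ∣ n.factorial := by
        rw [hp.dvd_factorial]; omega
      have key : (p : ℚ) / ((n + 1).factorial : ℚ) = ((n.factorial : ℕ) : ℚ)⁻¹ := by
        rw [Nat.factorial_succ, h]
        push_cast
        field_simp
      rw [key]
      exact inv_natCast_mem_padicIntegralRat this
    · have hd : ¬ p ∣ n + 1 := by
        rintro ⟨c, hc⟩
        have : c < 2 := by
          by_contra hcon
          have : p * 2 ≤ p * c := Nat.mul_le_mul_left _ (by omega)
          omega
        interval_cases c <;> omega
      have key : (p : ℚ) / ((n + 1).factorial : ℚ) =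
          (p : ℚ) / (n.factorial : ℚ) * ((n + 1 : ℕ) : ℚ)⁻¹ := by
        rw [Nat.factorial_succ]
        push_cast
        field_simp
      rw [key]
      exact mul_mem (ih (by omega)) (inv_natCast_mem_padicIntegralRat hd)

end Congruence

/-! ### Functional equation and p-integrality of Euler polynomials. -/

section EulerPolynomial

open PowerSeries

theorem eval_eulerPolynomial (n : ℕ) (x : ℚ) :
    (eulerPolynomial n).eval x =
      n.factorial * coeff n (2 * (exp ℚ + 1)⁻¹ * rescale x (exp ℚ)) := by
  have h : ∀ i : ℕ, (algebraMap ℚ (Polynomial ℚ)) (1 / (i.factorial : ℚ)) =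
      Polynomial.C (1 / (i.factorial : ℚ)) := fun _ => rfl
  rw [eulerPolynomial, Polynomial.eval_mul, Polynomial.eval_natCast]
  congr 1
  rw [coeff_mul, coeff_mul, Polynomial.eval_finsetSum]
  refine sum_congr rfl fun ij _ => ?_
  rw [Polynomial.eval_mul, coeff_map, Polynomial.eval_C, coeff_rescale, coeff_rescale, coeff_exp,
    coeff_exp, h, Polynomial.eval_mul, Polynomial.eval_C, Polynomial.eval_pow, Polynomial.eval_X]
  rfl

theorem exp_add_one_mul_inv : (exp ℚ + 1) * (2 * (exp ℚ + 1)⁻¹) = 2 := by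
  have : (exp ℚ + 1) * (exp ℚ + 1)⁻¹ = 1 := by
    apply PowerSeries.mul_inv_cancel
    simp
  linear_combination 2 * this

/-- Since e^(xz) + e^((x+1)z) = e^(xz)(1 + e^z), the denominator of the generating function cancels.
-/
theorem eval_eulerPolynomial_add_eval_add_one (n : ℕ) (x : ℚ) :
    (eulerPolynomial n).eval x + (eulerPolynomial n).eval (x + 1) = 2 * x ^ n := by
  have hexp : rescale (x + 1) (exp ℚ) = rescale x (exp ℚ) * exp ℚ := by
    rw [← exp_mul_exp_eq_exp_add, rescale_one]; rfl
  have hs : 2 * (exp ℚ + 1)⁻¹ * rescale x (exp ℚ) + 2 * (exp ℚ + 1)⁻¹ * rescale (x + 1) (exp ℚ) =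
      rescale x (exp ℚ) + rescale x (exp ℚ) := by
    rw [hexp]
    linear_combination rescale x (exp ℚ) * exp_add_one_mul_inv
  rw [eval_eulerPolynomial, eval_eulerPolynomial, ← mul_add, ← map_add, hs, map_add, coeff_rescale,
    coeff_exp]
  have : (n.factorial : ℚ) ≠ 0 := by exact_mod_cast n.factorial_ne_zero
  simp
  field_simp
  ring

theorem eval_eulerPolynomial_eq_sum (n : ℕ) (x : ℚ) :
    (eulerPolynomial n).eval x =
      ∑ i ∈ range (n + 1), (n.choose i : ℚ) * (eulerPolynomial i).eval 0 * x ^ (n - i) := by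
  have h0 : ∀ i, (eulerPolynomial i).eval 0 =
      i.factorial * coeff i (2 * (exp ℚ + 1)⁻¹) := by
    intro i
    rw [eval_eulerPolynomial, rescale_zero_apply]
    simp
  rw [eval_eulerPolynomial, coeff_mul, Finset.Nat.sum_antidiagonal_eq_sum_range_succ_mk, mul_sum]
  refine sum_congr rfl fun i hi => ?_
  have hi' : i ≤ n := by simpa [Nat.lt_succ_iff] using hi
  rw [h0, coeff_rescale, coeff_exp, Nat.cast_choose ℚ hi']
  have h1 : (i.factorial : ℚ) ≠ 0 := by exact_mod_cast i.factorial_ne_zero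
  have h2 : ((n - i).factorial : ℚ) ≠ 0 := by exact_mod_cast (n - i).factorial_ne_zero
  simp
  field_simp

variable {p : ℕ} [Fact p.Prime]

theorem inv_two_mem_padicIntegralRat (hp : Odd p) : (2 : ℚ)⁻¹ ∈ padicIntegralRat p := by
  have : ¬ p ∣ 2 := fun h => by
    have := (Nat.prime_dvd_prime_iff_eq Fact.out Nat.prime_two).1 h
    subst this
    exact absurd hp (by decide)
  exact_mod_cast inv_natCast_mem_padicIntegralRat this

/-- At x = 0 the functional equation expresses 2E_n(0) through earlier values with integer
coefficients, so only 2 is inverted. -/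
theorem eval_zero_eulerPolynomial_mem_padicIntegralRat (hp : Odd p) (n : ℕ) :
    (eulerPolynomial n).eval 0 ∈ padicIntegralRat p := by
  induction n using Nat.strong_induction_on with
  | _ n ih =>
    have h := eval_eulerPolynomial_add_eval_add_one n 0
    rw [zero_add, eval_eulerPolynomial_eq_sum n 1, sum_range_succ, Nat.choose_self] at h
    have key : (eulerPolynomial n).eval 0 = 0 ^ n - 2⁻¹ *
        ∑ i ∈ range n, (n.choose i : ℚ) * (eulerPolynomial i).eval 0 * 1 ^ (n - i) := by
      rw [Nat.cast_one, one_mul, one_pow, mul_one] at h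
      linear_combination h / 2
    rw [key]
    refine sub_mem (pow_mem (zero_mem _) _) (mul_mem (inv_two_mem_padicIntegralRat hp)
      (sum_mem fun i hi => ?_))
    exact mul_mem (mul_mem (natCast_mem _ _) (ih i (mem_range.1 hi))) (pow_mem (one_mem _) _)

theorem eval_eulerPolynomial_mem_padicIntegralRat (hp : Odd p) (n : ℕ) {x : ℚ}
    (hx : x ∈ padicIntegralRat p) : (eulerPolynomial n).eval x ∈ padicIntegralRat p := by
  rw [eval_eulerPolynomial_eq_sum]
  exact sum_mem fun i _ => mul_mem (mul_mem (natCast_mem _ _)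
    (eval_zero_eulerPolynomial_mem_padicIntegralRat hp i)) (pow_mem hx _)

theorem RatCong.eval_eulerPolynomial (hp : Odd p) (n : ℕ) {r : ℕ} {x y : ℚ}
    (hy : y ∈ padicIntegralRat p) (h : RatCong p r x y) :
    RatCong p r ((eulerPolynomial n).eval x) ((eulerPolynomial n).eval y) := by
  rw [eval_eulerPolynomial_eq_sum, eval_eulerPolynomial_eq_sum]
  exact RatCong.sum fun i _ => RatCong.mul_left (mul_mem (natCast_mem _ _)
    (eval_zero_eulerPolynomial_mem_padicIntegralRat hp i)) (h.pow hy _)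

end EulerPolynomial

/-! ### The truncated hypergeometric sum over ℚ. -/

section HypergeometricSum

/-- The `k`-th term of the hypergeometric series `₂F₁(-x, x + 1; 3 / 2; 1)`. -/
def hypTerm (x : ℚ) (k : ℕ) : ℚ :=
  ∏ j ∈ range k, ((j : ℚ) - x) * (x + 1 + j) / (((j : ℚ) + 1) * (j + 3 / 2))

/-- The `k`-th term of the hypergeometric series `₂F₁(1 - x, 1 + x; 3 / 2; 1)`. -/
def hypShiftTerm (x : ℚ) (k : ℕ) : ℚ :=
  ∏ j ∈ range k, ((j : ℚ) + 1 - x) * (x + 1 + j) / (((j : ℚ) + 1) * (j + 3 / 2))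

/-- The truncated series `∑ k < n, hypTerm x k`, normalised by the factor `2 * x + 1`. -/
def hypSum (n : ℕ) (x : ℚ) : ℚ := (2 * x + 1) * ∑ k ∈ range n, hypTerm x k

theorem hypTerm_succ (x : ℚ) (k : ℕ) :
    hypTerm x (k + 1) = hypTerm x k * (((k : ℚ) - x) * (x + 1 + k) / ((k + 1) * (k + 3 / 2))) :=
  prod_range_succ _ _

theorem hypShiftTerm_succ (x : ℚ) (k : ℕ) :
    hypShiftTerm x (k + 1) =
      hypShiftTerm x k * (((k : ℚ) + 1 - x) * (x + 1 + k) / ((k + 1) * (k + 3 / 2))) :=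
  prod_range_succ _ _

theorem hypTerm_succ_eq_hypShiftTerm (x : ℚ) (k : ℕ) :
    hypTerm x (k + 1) = -x * (x + k + 1) / (((k : ℚ) + 1) * (k + 3 / 2)) * hypShiftTerm x k := by
  induction k with
  | zero => simp [hypTerm, hypShiftTerm]
  | succ k ih =>
    rw [hypTerm_succ, ih, hypShiftTerm_succ]
    push_cast
    ring

theorem hypTerm_sub_one_succ_eq_hypShiftTerm (x : ℚ) (k : ℕ) :
    hypTerm (x - 1) (k + 1) =
      x * (k + 1 - x) / (((k : ℚ) + 1) * (k + 3 / 2)) * hypShiftTerm x k := by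
  induction k with
  | zero => simp [hypTerm, hypShiftTerm]; ring
  | succ k ih =>
    rw [hypTerm_succ, ih, hypShiftTerm_succ]
    push_cast
    ring

/-- A telescoping identity: the new terms at x and x - 1 are both rational multiples of
`hypShiftTerm x n`, and combine to the increment of the right side. -/
theorem sum_hypTerm_add_sum_hypTerm (x : ℚ) (n : ℕ) :
    (2 * x + 1) * ∑ k ∈ range (n + 1), hypTerm x k +
      (2 * x - 1) * ∑ k ∈ range (n + 1), hypTerm (x - 1) k = 4 * x * hypShiftTerm x n := by
  induction n with
  | zero => simp [hypTerm, hypShiftTerm]; ring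
  | succ n ih =>
    rw [sum_range_succ, sum_range_succ _ (n + 1), mul_add, mul_add, add_add_add_comm, ih,
      hypTerm_succ_eq_hypShiftTerm, hypTerm_sub_one_succ_eq_hypShiftTerm, hypShiftTerm_succ]
    have h1 : (n : ℚ) + 1 ≠ 0 := by positivity
    have h2 : (n : ℚ) + 3 / 2 ≠ 0 := by positivity
    have h3 : (n : ℚ) * 2 + 3 ≠ 0 := by positivity
    field_simp
    ring

theorem hypSum_add_hypSum_sub_one (x : ℚ) (n : ℕ) :
    hypSum (n + 1) x + hypSum (n + 1) (x - 1) = 4 * x * hypShiftTerm x n := by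
  rw [← sum_hypTerm_add_sum_hypTerm, hypSum, hypSum]
  ring

theorem hypSum_neg_one_sub (n : ℕ) (x : ℚ) : hypSum n (-1 - x) = -hypSum n x := by
  have : ∀ k, hypTerm (-1 - x) k = hypTerm x k := fun k =>
    prod_congr rfl fun j _ => by ring
  simp only [hypSum, this]
  ring

theorem prod_add_one_mul_add_three_halves (k : ℕ) :
    ∏ j ∈ range k, (((j : ℚ) + 1) * (j + 3 / 2)) = ((2 * k + 1).factorial : ℚ) / 4 ^ k := by
  induction k with
  | zero => simp
  | succ k ih =>
    rw [prod_range_succ, ih, show 2 * (k + 1) + 1 = 2 * k + 1 + 1 + 1 by ring,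
      Nat.factorial_succ (2 * k + 1 + 1), Nat.factorial_succ (2 * k + 1)]
    push_cast
    field_simp
    ring

theorem hypShiftTerm_eq (x : ℚ) (k : ℕ) :
    hypShiftTerm x k = (∏ j ∈ range k, ((j : ℚ) + 1 - x)) * (∏ j ∈ range k, (x + 1 + j)) *
      (4 ^ k / ((2 * k + 1).factorial : ℚ)) := by
  rw [hypShiftTerm, prod_div_distrib, prod_add_one_mul_add_three_halves, prod_mul_distrib,
    div_eq_mul_inv, inv_div]

theorem prod_range_natCast_sub (n : ℕ) :
    ∏ j ∈ range n, ((j : ℚ) - n) = (-1) ^ n * (n.factorial : ℚ) := by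
  rw [← Nat.descFactorial_self, Nat.descFactorial_eq_prod_range, Nat.cast_prod,
    ← card_range n, ← prod_const, card_range, ← prod_mul_distrib]
  refine prod_congr rfl fun j hj => ?_
  rw [Nat.cast_sub (mem_range.1 hj).le]
  ring

theorem factorial_mul_prod_range_add (n : ℕ) :
    ((n + 1).factorial : ℚ) * ∏ j ∈ range n, ((n : ℚ) + 2 + j) = ((2 * n + 1).factorial : ℚ) := by
  have h := Nat.factorial_mul_ascFactorial (n + 1) n
  rw [Nat.ascFactorial_eq_prod_range, show n + 1 + n = 2 * n + 1 by ring] at h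
  rw [← h]
  push_cast
  congr 1
  exact prod_congr rfl fun j _ => by ring

/-- The numerator products are (-1)^n n! and (2n + 1)!/(n + 1)!, so all factorials cancel. With n =
p - 1 this yields F(p). -/
theorem mul_hypShiftTerm_succ_self (n : ℕ) :
    4 * ((n : ℚ) + 1) * hypShiftTerm ((n : ℚ) + 1) n = (-1) ^ n * 4 ^ (n + 1) := by
  have h1 : ∏ j ∈ range n, ((j : ℚ) + 1 - (n + 1)) = (-1) ^ n * (n.factorial : ℚ) := by
    rw [← prod_range_natCast_sub]
    exact prod_congr rfl fun j _ => by ring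
  have h2 : ∏ j ∈ range n, ((n : ℚ) + 1 + 1 + j) = ∏ j ∈ range n, ((n : ℚ) + 2 + j) :=
    prod_congr rfl fun j _ => by ring
  have h3 : ((2 * n + 1).factorial : ℚ) ≠ 0 := by exact_mod_cast Nat.factorial_ne_zero _
  have h4 := factorial_mul_prod_range_add n
  rw [Nat.factorial_succ] at h4
  push_cast at h4
  rw [hypShiftTerm_eq, h1, h2]
  field_simp
  linear_combination 4 * 4 ^ n * h4

theorem hypShiftTerm_eq_zero {m n : ℕ} (h : m < n) : hypShiftTerm ((m : ℚ) + 1) n = 0 :=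
  prod_eq_zero (mem_range.2 h) (by simp)

/-- The right side of the recurrence vanishes at these integers, so the sign alternates from the
value 1 at 0. -/
theorem hypSum_natCast {m n : ℕ} (h : m ≤ n) : hypSum (n + 1) m = (-1) ^ m := by
  induction m with
  | zero =>
    have : ∀ k ∈ range n, hypTerm 0 (k + 1) = 0 := fun k _ =>
      prod_eq_zero (mem_range.2 k.succ_pos) (by simp)
    rw [hypSum, sum_range_succ', Nat.cast_zero, sum_eq_zero this]
    simp [hypTerm]
  | succ m ih =>
    have h1 := hypSum_add_hypSum_sub_one ((m : ℚ) + 1) n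
    rw [hypShiftTerm_eq_zero (by omega), add_sub_cancel_right, ih (by omega)] at h1
    push_cast
    rw [pow_succ]
    linear_combination h1

end HypergeometricSum

/-! ### Wilson-type products modulo p. -/

section Prime

variable {p : ℕ} [Fact p.Prime]

theorem prod_univ_zmod_eq_prod_range (f : ZMod p → ZMod p) :
    ∏ x : ZMod p, f x = ∏ j ∈ range p, f j := by
  refine prod_nbij' (fun x => x.val) (fun j => (j : ZMod p)) ?_ ?_ ?_ ?_ ?_
  · exact fun x _ => mem_range.2 x.val_lt
  · exact fun _ _ => mem_univ _
  · exact fun x _ => ZMod.natCast_zmod_val x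
  · exact fun j hj => ZMod.val_cast_of_lt (mem_range.1 hj)
  · exact fun x _ => by rw [ZMod.natCast_zmod_val]

theorem prod_univ_zmod_ite : ∏ x : ZMod p, (if x = 0 then 1 else x) = -1 := by
  have hp : p.Prime := Fact.out
  rw [prod_univ_zmod_eq_prod_range, range_eq_Ico, prod_eq_prod_Ico_succ_bot hp.pos, Nat.cast_zero,
    if_pos rfl, one_mul, ← ZMod.prod_Ico_one_prime p]
  refine prod_congr rfl fun j hj => if_neg fun h => ?_
  rw [ZMod.natCast_eq_zero_iff] at h
  have := Nat.le_of_dvd (by simp at hj; omega) h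
  simp at hj
  omega

/-- The product runs over all nonzero residues except -m; restoring -m gives Wilson's -1. -/
theorem prod_range_zmod_ite_sub {m : ℕ} (h1 : 1 ≤ m) (h2 : m < p) :
    (∏ j ∈ range (p - 1), (if j + 1 = m then 1 else (j : ZMod p) + 1 - m)) * (m : ZMod p) = 1 := by
  have hp : p.Prime := Fact.out
  have h := prod_univ_zmod_ite (p := p)
  rw [← Equiv.prod_comp (Equiv.subRight (m : ZMod p)), prod_univ_zmod_eq_prod_range,
    show range p = range (p - 1 + 1) by rw [Nat.sub_add_cancel hp.one_le], prod_range_succ'] at h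
  have hm : (m : ZMod p) ≠ 0 := fun h => by
    rw [ZMod.natCast_eq_zero_iff] at h
    have := Nat.le_of_dvd h1 h
    omega
  simp only [Equiv.subRight_apply, Nat.cast_zero, zero_sub, neg_eq_zero, hm, if_false] at h
  rw [mul_neg, neg_inj] at h
  refine Eq.trans ?_ h
  congr 1
  refine prod_congr rfl fun j hj => ?_
  rw [mem_range] at hj
  have : ((j + 1 : ℕ) : ZMod p) - m = 0 ↔ j + 1 = m := by
    rw [sub_eq_zero, ZMod.natCast_eq_natCast_iff', Nat.mod_eq_of_lt h2,
      Nat.mod_eq_of_lt (by omega)]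
  simp only [this]
  push_cast
  rfl

theorem zmod_pow_sub_two_mul_self {m : ℕ} (h2 : ¬ p ∣ m) :
    (m : ZMod p) ^ (p - 2) * m = 1 := by
  have hp : p.Prime := Fact.out
  have hm : (m : ZMod p) ≠ 0 := fun h => h2 ((ZMod.natCast_eq_zero_iff _ _).1 h)
  rw [← pow_succ, show p - 2 + 1 = p - 1 by have := hp.two_le; omega, ZMod.pow_card_sub_one_eq_one hm]

end Prime

/-! ### The truncated sum modulo p². -/

section Supercongruence

variable {p : ℕ} [Fact p.Prime]

/-- The numerator pairs into factors (j + 1)² - (pt)², which lose their dependence on t modulo p².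
The prefactor -pt supplies the p that may divide (2k + 3)!. What matters is that c does not depend
on t. -/
theorem hypTerm_prime_mul_ratCong {k : ℕ} (hk : k + 1 < p) :
    ∃ c ∈ padicIntegralRat p, ∀ t ∈ padicIntegralRat p,
      RatCong p 2 (hypTerm (p * t) (k + 1)) (-t * (p * t + k + 1) * c) := by
  have hW : (4 : ℚ) ^ (k + 1) * ((p : ℚ) / ((2 * (k + 1) + 1).factorial : ℚ)) ∈
      padicIntegralRat p :=
    mul_mem (pow_mem (ofNat_mem _ 4) _) (prime_div_factorial_mem_padicIntegralRat (by omega))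
  set W : ℚ := (4 : ℚ) ^ (k + 1) * ((p : ℚ) / ((2 * (k + 1) + 1).factorial : ℚ)) with hWdef
  have hint : ∀ j : ℕ, ((j : ℚ) + 1) ^ 2 ∈ padicIntegralRat p := fun j =>
    pow_mem (add_mem (natCast_mem _ j) (one_mem _)) 2
  refine ⟨W * ∏ j ∈ range k, ((j : ℚ) + 1) ^ 2, mul_mem hW (prod_mem fun j _ => hint j), ?_⟩
  intro t ht
  have hprod : RatCong p 2 (∏ j ∈ range k, (((j : ℚ) + 1) ^ 2 - (p * t) ^ 2))
      (∏ j ∈ range k, ((j : ℚ) + 1) ^ 2) :=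
    RatCong.prod (fun j _ => hint j) fun j _ => ⟨-t ^ 2, neg_mem (pow_mem ht 2), by ring⟩
  have heq : hypTerm (p * t) (k + 1) =
      -t * (p * t + k + 1) * W * ∏ j ∈ range k, (((j : ℚ) + 1) ^ 2 - (p * t) ^ 2) := by
    have h1 : ∏ j ∈ range k, (((j : ℚ) + 1) ^ 2 - (p * t) ^ 2) =
        (∏ j ∈ range k, ((j : ℚ) + 1 - p * t)) * ∏ j ∈ range k, (p * t + 1 + (j : ℚ)) := by
      rw [← prod_mul_distrib]
      exact prod_congr rfl fun j _ => by ring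
    have h2 := prod_add_one_mul_add_three_halves k
    have h3 := prod_add_one_mul_add_three_halves (k + 1)
    rw [prod_range_succ, h2] at h3
    have h4 : ((2 * k + 1).factorial : ℚ) ≠ 0 := by exact_mod_cast Nat.factorial_ne_zero _
    have h5 : ((2 * (k + 1) + 1).factorial : ℚ) ≠ 0 := by exact_mod_cast Nat.factorial_ne_zero _
    have h6 : (k : ℚ) + 1 ≠ 0 := by positivity
    have h7 : (k : ℚ) + 3 / 2 ≠ 0 := by positivity
    have h8 : W = p * ((4 ^ k / ((2 * k + 1).factorial : ℚ)) / ((k + 1) * (k + 3 / 2))) := by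
      rw [hWdef, ← inv_div ((2 * k + 1).factorial : ℚ), ← one_div, div_div, h3]
      field_simp
    rw [hypTerm_succ_eq_hypShiftTerm, hypShiftTerm_eq, h1, h8]
    ring
  rw [heq]
  refine (RatCong.mul_left (mul_mem (mul_mem (neg_mem ht) ?_) hW) hprod).trans
    (RatCong.of_eq (by ring))
  exact add_mem (add_mem (mul_mem (natCast_mem _ p) ht) (natCast_mem _ k)) (one_mem _)

theorem exists_hypSum_prime_mul_ratCong :
    ∃ A ∈ padicIntegralRat p, ∃ B ∈ padicIntegralRat p, ∀ t ∈ padicIntegralRat p,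
      RatCong p 2 (hypSum p (p * t)) (1 + A * t + B * t ^ 2) := by
  have hp : p.Prime := Fact.out
  -- The bound on k sits inside the existential so that `choose` yields a total c, with default 0.
  have h : ∀ k : ℕ, ∃ c ∈ padicIntegralRat p, k + 1 < p → ∀ t ∈ padicIntegralRat p,
      RatCong p 2 (hypTerm (p * t) (k + 1)) (-t * (p * t + k + 1) * c) := by
    intro k
    by_cases hk : k + 1 < p
    · obtain ⟨c, hc, h⟩ := hypTerm_prime_mul_ratCong hk
      exact ⟨c, hc, fun _ => h⟩
    · exact ⟨0, zero_mem _, fun h => absurd h hk⟩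
  choose c hc h using h
  set S0 := ∑ k ∈ range (p - 1), c k
  set S1 := ∑ k ∈ range (p - 1), ((k : ℚ) + 1) * c k
  have hS0 : S0 ∈ padicIntegralRat p := sum_mem fun k _ => hc k
  have hS1 : S1 ∈ padicIntegralRat p :=
    sum_mem fun k _ => mul_mem (add_mem (natCast_mem _ k) (one_mem _)) (hc k)
  have hpm : (p : ℚ) ∈ padicIntegralRat p := natCast_mem _ p
  have h2m : (2 : ℚ) ∈ padicIntegralRat p := ofNat_mem _ 2
  -- Coefficients of t and t² in (1 + 2pt)(1 - t·S1 - pt²·S0); the cubic term carries p².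
  refine ⟨2 * p - S1, sub_mem (mul_mem h2m hpm) hS1, -p * S0 - 2 * p * S1,
    sub_mem (mul_mem (neg_mem hpm) hS0) (mul_mem (mul_mem h2m hpm) hS1), fun t ht => ?_⟩
  have hF : RatCong p 2 (∑ k ∈ range p, hypTerm (p * t) k) (1 - t * S1 - p * t ^ 2 * S0) := by
    rw [show range p = range (p - 1 + 1) by rw [Nat.sub_add_cancel hp.one_le], sum_range_succ']
    have hs := RatCong.sum (p := p) (r := 2) (s := range (p - 1))
      (f := fun k => hypTerm (p * t) (k + 1)) (g := fun k => -t * (p * t + k + 1) * c k)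
      fun k hk => h k (by rw [mem_range] at hk; omega) t ht
    refine (hs.add (RatCong.refl _)).trans (RatCong.of_eq ?_)
    rw [show ∑ k ∈ range (p - 1), -t * (p * t + k + 1) * c k = -t * S1 - p * t ^ 2 * S0 by
      rw [mul_sum, mul_sum, ← sum_sub_distrib]
      exact sum_congr rfl fun k _ => by ring]
    simp [hypTerm]
    ring
  have hm : (2 * (p * t) + 1 : ℚ) ∈ padicIntegralRat p :=
    add_mem (mul_mem h2m (mul_mem hpm ht)) (one_mem _)
  refine (hF.mul_left hm).trans ⟨-2 * S0 * t ^ 3, ?_, by ring⟩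
  exact mul_mem (mul_mem (neg_mem h2m) hS0) (pow_mem ht 3)

theorem hypSum_prime_mul_ratCong (hp : Odd p) {t : ℚ} (ht : t ∈ padicIntegralRat p) :
    RatCong p 2 (hypSum p (p * t)) (1 + 2 * t + 2 * t * (t + 1) * (4 ^ (p - 1) - 1)) := by
  obtain ⟨A, hA, B, hB, h⟩ := exists_hypSum_prime_mul_ratCong (p := p)
  obtain ⟨n, rfl⟩ : ∃ n, p = n + 1 := ⟨p - 1, by have := (Fact.out : p.Prime).pos; omega⟩
  have hn : Even n := by simpa [Nat.odd_add_one, parity_simps] using hp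
  have e1 := hypSum_natCast (le_refl n)
  rw [hn.neg_one_pow] at e1
  have e2 := hypSum_add_hypSum_sub_one ((n : ℚ) + 1) n
  rw [mul_hypShiftTerm_succ_self, hn.neg_one_pow, add_sub_cancel_right, e1] at e2
  have e3 := hypSum_neg_one_sub (n + 1) (n : ℚ)
  rw [e1] at e3
  have c1 := h 1 (one_mem _)
  have c2 := h (-1) (neg_mem (one_mem _))
  push_cast at c1 c2
  rw [mul_one, show hypSum (n + 1) ((n : ℚ) + 1) = 4 ^ (n + 1) - 1 by linarith] at c1
  rw [show ((n : ℚ) + 1) * -1 = -1 - n by ring, e3] at c2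
  have h2 := inv_two_mem_padicIntegralRat hp
  -- Interpolation from F(p) = 4^p - 1 and F(-p) = -1: half the difference gives A, half the sum
  -- gives 1 + B.
  have cA := (c1.sub c2).mul_left (mul_mem h2 ht)
  have cB := (c1.add c2).mul_left (mul_mem h2 (pow_mem ht 2))
  refine (h t ht).trans ?_
  have := ((cA.add cB).add (RatCong.refl (1 - t ^ 2))).symm
  refine (RatCong.of_eq ?_).trans (this.trans (RatCong.of_eq ?_))
  · ring
  · rw [Nat.add_sub_cancel]
    ring

theorem prod_range_eq_mul_prod_ite {n l : ℕ} (hl : l < n) (f : ℕ → ℚ) :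
    ∏ j ∈ range n, f j = f l * ∏ j ∈ range n, if j = l then 1 else f j := by
  rw [← mul_prod_erase _ f (mem_range.2 hl), ← mul_prod_erase _ _ (mem_range.2 hl), if_pos rfl,
    one_mul]
  congr 1
  exact prod_congr rfl fun j hj => (if_neg (ne_of_mem_erase hj)).symm

/-- Without its factor p, (2p - 1)! is a product of two blocks, each ≡ -1 by Wilson; and 4^(p-1) ≡ 1
by Fermat. -/
theorem prime_mul_four_pow_div_factorial_ratCong (hp : Odd p) :
    RatCong p 1 (4 ^ (p - 1) * (p / ((2 * (p - 1) + 1).factorial : ℚ))) 1 := by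
  have hpr : p.Prime := Fact.out
  have hV : (4 : ℚ) ^ (p - 1) * ((p : ℚ) / ((2 * (p - 1) + 1).factorial : ℚ)) ∈
      padicIntegralRat p :=
    mul_mem (pow_mem (ofNat_mem _ 4) _)
      (prime_div_factorial_mem_padicIntegralRat (by have := hpr.pos; omega))
  set V := (4 : ℚ) ^ (p - 1) * ((p : ℚ) / ((2 * (p - 1) + 1).factorial : ℚ)) with hVdef
  have hN := factorial_mul_prod_range_add (p - 1)
  rw [Nat.factorial_succ, Nat.sub_add_cancel hpr.one_le] at hN
  set N : ℤ := ((p - 1).factorial : ℤ) * ∏ j ∈ range (p - 1), ((p : ℤ) + 1 + j) with hNdef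
  have hcast : ((p - 1 : ℕ) : ℚ) = (p : ℚ) - 1 := by rw [Nat.cast_sub hpr.one_le, Nat.cast_one]
  have hVN : V * N = 4 ^ (p - 1) := by
    have h0 : ((2 * (p - 1) + 1).factorial : ℚ) ≠ 0 := by
      exact_mod_cast Nat.factorial_ne_zero _
    have : ((2 * (p - 1) + 1).factorial : ℚ) = p * N := by
      rw [← hN, hNdef, hcast]
      push_cast
      rw [mul_assoc]
      congr 2
      exact prod_congr rfl fun j _ => by ring
    rw [hVdef, this]
    rw [this] at h0
    have := left_ne_zero_of_mul h0
    have := right_ne_zero_of_mul h0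
    field_simp
  have hN1 : (N : ZMod p) = ((1 : ℤ) : ZMod p) := by
    have hf : (∏ j ∈ range (p - 1), ((j : ZMod p) + 1)) = -1 := by
      rw [← ZMod.wilsons_lemma p, ← prod_range_add_one_eq_factorial]
      push_cast
      rfl
    rw [hNdef]
    push_cast
    rw [ZMod.wilsons_lemma p]
    simp only [CharP.cast_eq_zero, zero_add, add_comm (1 : ZMod p), hf]
    norm_num
  have h4 : (((4 : ℤ) ^ (p - 1) : ℤ) : ZMod p) = ((1 : ℤ) : ZMod p) := by
    push_cast
    refine ZMod.pow_card_sub_one_eq_one fun h => ?_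
    have h4 : p ∣ 2 ^ 2 := (ZMod.natCast_eq_zero_iff 4 p).1 (by exact_mod_cast h)
    have := (Nat.prime_dvd_prime_iff_eq hpr Nat.prime_two).1 (hpr.dvd_of_dvd_pow h4)
    subst this
    exact absurd hp (by decide)
  have c1 := (RatCong.of_intCast_zmod hN1).mul_left hV
  have c2 := RatCong.of_intCast_zmod h4
  rw [hVN] at c1
  push_cast at c1 c2
  rw [mul_one] at c1
  exact c1.symm.trans c2

/-- Each numerator product has one distinguished factor: -pt at j = m - 1 and p(t + 1) at j = p - m
- 1. One p cancels against (2p - 1)!, so the cofactor is needed only modulo p; its two remaining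
products X, Y are ≡ 1/m and -1/m. -/
theorem mul_hypShiftTerm_ratCong (hp : Odd p) {t : ℚ} (ht : t ∈ padicIntegralRat p) {m : ℕ}
    (h1 : 1 ≤ m) (h2 : m < p) :
    RatCong p 2 (4 * (p * t + m) * hypShiftTerm (p * t + m) (p - 1))
      (4 * t * (t + 1) * (p * m ^ (p - 2))) := by
  have hpr : p.Prime := Fact.out
  have hV := prime_mul_four_pow_div_factorial_ratCong hp
  set V := (4 : ℚ) ^ (p - 1) * ((p : ℚ) / ((2 * (p - 1) + 1).factorial : ℚ)) with hVdef
  set X := ∏ j ∈ range (p - 1), (if j = m - 1 then 1 else (j : ℚ) + 1 - (p * t + m)) with hX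
  set Y := ∏ j ∈ range (p - 1), (if j = p - m - 1 then 1 else p * t + m + 1 + (j : ℚ)) with hY
  set X0 : ℤ := ∏ j ∈ range (p - 1), (if j = m - 1 then 1 else (j : ℤ) + 1 - m) with hX0
  set Y0 : ℤ := ∏ j ∈ range (p - 1), (if j = p - m - 1 then 1 else (m : ℤ) + 1 + j) with hY0
  have hprod : 4 * (p * t + m) * hypShiftTerm (p * t + m) (p - 1) =
      4 * t * (t + 1) * (p * (-((p * t + m) * (X * Y) * V))) := by
    have hm : ((m - 1 : ℕ) : ℚ) = m - 1 := by rw [Nat.cast_sub h1, Nat.cast_one]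
    have hpm : ((p - m - 1 : ℕ) : ℚ) = p - m - 1 := by
      rw [Nat.cast_sub (by omega), Nat.cast_sub h2.le, Nat.cast_one]
    rw [hypShiftTerm_eq, prod_range_eq_mul_prod_ite (show m - 1 < p - 1 by omega)
      (fun j => (j : ℚ) + 1 - (p * t + m)), prod_range_eq_mul_prod_ite
      (show p - m - 1 < p - 1 by omega) (fun j => p * t + m + 1 + (j : ℚ)), ← hX, ← hY, hm, hpm,
      hVdef]
    ring
  have cX : RatCong p 1 X X0 := by
    rw [hX, hX0, Int.cast_prod]
    refine RatCong.prod (fun j _ => intCast_mem _ _) fun j _ => ?_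
    split_ifs
    · exact RatCong.of_eq (by norm_num)
    · exact ⟨-t, neg_mem ht, by push_cast; ring⟩
  have cY : RatCong p 1 Y Y0 := by
    rw [hY, hY0, Int.cast_prod]
    refine RatCong.prod (fun j _ => intCast_mem _ _) fun j _ => ?_
    split_ifs
    · exact RatCong.of_eq (by norm_num)
    · exact ⟨t, ht, by push_cast; ring⟩
  have ca : RatCong p 1 (p * t + m) (m : ℤ) := ⟨t, ht, by push_cast; ring⟩
  have hX0z : (X0 : ZMod p) * m = 1 := by
    rw [← prod_range_zmod_ite_sub h1 h2, hX0]
    push_cast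
    congr 1
    refine prod_congr rfl fun j _ => ?_
    simp only [show j = m - 1 ↔ j + 1 = m by omega]
  have hY0z : (Y0 : ZMod p) * m = -1 := by
    have := prod_range_zmod_ite_sub (p := p) (m := p - m) (by omega) (by omega)
    rw [Nat.cast_sub h2.le, CharP.cast_eq_zero, zero_sub, mul_neg] at this
    rw [← this, neg_neg, hY0]
    push_cast
    congr 1
    refine prod_congr rfl fun j _ => ?_
    simp only [show j = p - m - 1 ↔ j + 1 = p - m by omega]
    congr 1
    ring
  have hmz := zmod_pow_sub_two_mul_self (p := p) (m := m)
    fun h => by have := Nat.le_of_dvd h1 h; omega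
  have hz : ((-(m * (X0 * Y0)) : ℤ) : ZMod p) = (((m : ℤ) ^ (p - 2) : ℤ) : ZMod p) := by
    push_cast
    linear_combination -(Y0 : ZMod p) * hX0z - (m : ZMod p) ^ (p - 2) * hY0z + (Y0 : ZMod p) * hmz
  rw [hprod]
  refine RatCong.mul_left (mul_mem (mul_mem (ofNat_mem _ 4) ht) (add_mem ht (one_mem _)))
    (RatCong.prime_mul ?_)
  have hXm := cX.mem_of_mem (intCast_mem _ _)
  have hYm := cY.mem_of_mem (intCast_mem _ _)
  have c1 := ca.mul (intCast_mem _ _) (mul_mem hXm hYm) (cX.mul (intCast_mem _ _) hYm cY)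
  have c2 := c1.mul (mul_mem (intCast_mem _ _) (mul_mem (intCast_mem _ _) (intCast_mem _ _)))
    (hV.mem_of_mem (one_mem _)) hV
  refine c2.neg.trans ?_
  have c3 := RatCong.of_intCast_zmod hz
  push_cast at c3 ⊢
  rwa [mul_one]

end Supercongruence

/-! ### The value of E_{p-2}(0) and the Fermat quotient of 2. -/

section EulerValue

theorem neg_one_pow_mul_eval_neg_eulerPolynomial (n N : ℕ) :
    (-1) ^ N * (eulerPolynomial n).eval (-N : ℚ) =
      (eulerPolynomial n).eval 0 + 2 * ∑ m ∈ range N, (-1) ^ (m + 1) * (-((m : ℚ) + 1)) ^ n := by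
  induction N with
  | zero => simp
  | succ N ih =>
    have h := eval_eulerPolynomial_add_eval_add_one n (-((N + 1 : ℕ) : ℚ))
    rw [sum_range_succ, mul_add, ← add_assoc, ← ih]
    rw [show -((N + 1 : ℕ) : ℚ) + 1 = -N by push_cast; ring] at h
    push_cast at h ⊢
    rw [pow_succ]
    linear_combination -(-1 : ℚ) ^ N * h

variable {p : ℕ} [Fact p.Prime]

theorem choose_prime_sub_one_zmod {m : ℕ} (hm : m < p) :
    ((p - 1).choose m : ZMod p) = (-1) ^ m := by
  have hpr : p.Prime := Fact.out
  induction m with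
  | zero => simp
  | succ m ih =>
    have h : (p.choose (m + 1) : ZMod p) = 0 :=
      (ZMod.natCast_eq_zero_iff _ _).2 (hpr.dvd_choose_self (by omega) hm)
    have hc : p.choose (m + 1) = (p - 1).choose m + (p - 1).choose (m + 1) := by
      rw [← Nat.choose_succ_succ, Nat.succ_eq_add_one, Nat.sub_add_cancel hpr.one_le]
    rw [hc] at h
    push_cast at h
    rw [ih (by omega)] at h
    rw [pow_succ]
    linear_combination h

/-- Expand 2^p binomially and use C(p, m+1)/p ≡ (-1)^m/(m + 1), with the inverse written as a (p -
2)th power. -/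
theorem two_pow_prime_sub_two_ratCong :
    RatCong p 2 (2 ^ p - 2) (p * ∑ m ∈ range (p - 1), (-1) ^ m * ((m : ℚ) + 1) ^ (p - 2)) := by
  have hpr : p.Prime := Fact.out
  have hsum : (2 : ℚ) ^ p - 2 =
      p * ∑ m ∈ range (p - 1), ((p.choose (m + 1) / p : ℕ) : ℚ) := by
    have h := Nat.sum_range_choose p
    rw [sum_range_succ, Nat.choose_self,
      show range p = range (p - 1 + 1) by rw [Nat.sub_add_cancel hpr.one_le], sum_range_succ',
      Nat.choose_zero_right] at h
    have h' : ((∑ m ∈ range (p - 1), p.choose (m + 1) + 1 + 1 : ℕ) : ℚ) = 2 ^ p := by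
      rw [h]; push_cast; rfl
    push_cast at h'
    rw [← h', mul_sum]
    rw [add_assoc, show (1 : ℚ) + 1 = 2 by norm_num, add_sub_cancel_right]
    refine sum_congr rfl fun m hm => ?_
    rw [mem_range] at hm
    exact_mod_cast (Nat.mul_div_cancel' (hpr.dvd_choose_self m.succ_ne_zero (by omega))).symm
  rw [hsum]
  refine RatCong.prime_mul (RatCong.sum fun m hm => ?_)
  rw [mem_range] at hm
  have hd := Nat.mul_div_cancel' (hpr.dvd_choose_self m.succ_ne_zero (show m + 1 < p by omega))
  set c := p.choose (m + 1) / p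
  have hc : c * (m + 1) = (p - 1).choose m := by
    have h := Nat.add_one_mul_choose_eq (p - 1) m
    rw [Nat.sub_add_cancel hpr.one_le, ← hd, mul_assoc] at h
    exact (Nat.eq_of_mul_eq_mul_left hpr.pos h).symm
  have hcz : (c : ZMod p) * (m + 1) = (-1) ^ m := by
    rw [← choose_prime_sub_one_zmod (show m < p by omega), ← hc]
    push_cast
    rfl
  have hmz := zmod_pow_sub_two_mul_self (p := p) (m := m + 1)
    fun h => by have := Nat.le_of_dvd m.succ_pos h; omega
  push_cast at hmz
  have hz : ((c : ℤ) : ZMod p) = (((-1) ^ m * ((m : ℤ) + 1) ^ (p - 2) : ℤ) : ZMod p) := by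
    push_cast
    linear_combination ((m : ZMod p) + 1) ^ (p - 2) * hcz - (c : ZMod p) * hmz
  have := RatCong.of_intCast_zmod hz
  push_cast at this
  exact this

/-- Going from 0 down to -p by the functional equation, and using E_{p-2}(-p) ≡ E_{p-2}(0), gives
E_{p-2}(0) ≡ -S modulo p. -/
theorem prime_mul_eval_zero_eulerPolynomial_ratCong (hp : Odd p) :
    RatCong p 2 (p * (eulerPolynomial (p - 2)).eval 0) (-(4 ^ (p - 1) - 1)) := by
  have hpr : p.Prime := Fact.out
  have hp3 : 3 ≤ p := by
    have := hpr.two_le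
    obtain ⟨k, hk⟩ := hp
    omega
  have hodd : Odd (p - 2) := by
    obtain ⟨k, hk⟩ := hp
    exact ⟨k - 1, by omega⟩
  set E := (eulerPolynomial (p - 2)).eval (0 : ℚ) with hE
  set S := ∑ m ∈ range (p - 1), (-1) ^ m * ((m : ℚ) + 1) ^ (p - 2) with hS
  have h2 := inv_two_mem_padicIntegralRat hp
  have h := neg_one_pow_mul_eval_neg_eulerPolynomial (p - 2) p
  have hsum : ∑ m ∈ range p, (-1) ^ (m + 1) * (-((m : ℚ) + 1)) ^ (p - 2) =
      S + p ^ (p - 2) := by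
    rw [show range p = range (p - 1 + 1) by rw [Nat.sub_add_cancel hpr.one_le], sum_range_succ,
      Nat.sub_add_cancel hpr.one_le, hp.neg_one_pow, Nat.cast_sub hpr.one_le, hodd.neg_pow,
      Nat.cast_one, sub_add_cancel]
    rw [hS]
    congr 1
    · refine sum_congr rfl fun m _ => ?_
      rw [hodd.neg_pow, pow_succ]
      ring
    · ring
  rw [hsum, hp.neg_one_pow] at h
  have hEp : RatCong p 1 ((eulerPolynomial (p - 2)).eval (-p : ℚ)) E :=
    RatCong.eval_eulerPolynomial hp _ (zero_mem _) ⟨-1, neg_mem (one_mem _), by ring⟩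
  have hpp : RatCong p 1 ((p : ℚ) ^ (p - 2)) 0 :=
    ⟨(p : ℚ) ^ (p - 3), pow_mem (natCast_mem _ p) _, by
      rw [sub_zero, ← pow_add]; congr 1; omega⟩
  have hES : RatCong p 1 E (-S) := by
    have := (((RatCong.refl E).sub hEp).mul_left h2).sub (hpp.add (RatCong.refl S))
    refine (RatCong.of_eq ?_).trans (this.trans (RatCong.of_eq ?_))
    · linear_combination -h / 2
    · ring
  have h2z : (((2 : ℤ) ^ (p - 1) : ℤ) : ZMod p) = ((1 : ℤ) : ZMod p) := by
    push_cast
    refine ZMod.pow_card_sub_one_eq_one fun h => ?_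
    have := Nat.le_of_dvd two_pos ((ZMod.natCast_eq_zero_iff 2 p).1 (by exact_mod_cast h))
    omega
  obtain ⟨z, hz, e⟩ := RatCong.of_intCast_zmod h2z
  push_cast at e
  -- With u = 2^(p-1), the difference is (u - 1)².
  have hq : RatCong p 2 (4 ^ (p - 1) - 1) (2 ^ p - 2) := by
    refine ⟨z ^ 2, pow_mem hz 2, ?_⟩
    have e4 : (4 : ℚ) ^ (p - 1) = (2 ^ (p - 1)) ^ 2 := by
      rw [← pow_mul, mul_comm, pow_mul]
      norm_num
    have e2 : (2 : ℚ) ^ p = 2 * 2 ^ (p - 1) := by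
      rw [← pow_succ', Nat.sub_add_cancel hpr.one_le]
    rw [e4, e2]
    linear_combination (2 ^ (p - 1) - 1 + p * z) * e
  refine hES.prime_mul.trans ?_
  rw [mul_neg]
  exact (hq.trans two_pow_prime_sub_two_ratCong).neg.symm

end EulerValue

/-! ### Assembly and the three specializations. -/

section Main

variable {p : ℕ} [Fact p.Prime]

/-- Induction on n: p - 2 is odd, so E_{p-2}(-m) + E_{p-2}(1 - m) = -2m^(p-2), which cancels the
inhomogeneous term of the recurrence for F. -/
theorem hypSum_add_eval_eulerPolynomial_ratCong (hp : Odd p) {t : ℚ}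
    (ht : t ∈ padicIntegralRat p) {n : ℕ} (hn : n < p) :
    RatCong p 2 (hypSum p (p * t + n) +
      2 * t * (t + 1) * (p * (eulerPolynomial (p - 2)).eval (-n : ℚ))) ((-1) ^ n * (1 + 2 * t)) := by
  have hpr : p.Prime := Fact.out
  have hodd : Odd (p - 2) := by
    have := hpr.two_le
    obtain ⟨k, hk⟩ := hp
    exact ⟨k - 1, by omega⟩
  induction n with
  | zero =>
    have c1 := hypSum_prime_mul_ratCong hp ht
    have h2 : (2 : ℚ) ∈ padicIntegralRat p := ofNat_mem _ 2
    have c2 := (prime_mul_eval_zero_eulerPolynomial_ratCong hp).mul_left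
      (mul_mem (mul_mem h2 ht) (add_mem ht (one_mem _)))
    rw [Nat.cast_zero, add_zero, neg_zero]
    exact (c1.add c2).trans (RatCong.of_eq (by ring))
  | succ n ih =>
    have c1 := (ih (by omega)).neg
    have c2 := mul_hypShiftTerm_ratCong hp ht n.succ_pos hn
    have e1 := hypSum_add_hypSum_sub_one (p * t + (n + 1 : ℕ)) (p - 1)
    have e2 := eval_eulerPolynomial_add_eval_add_one (p - 2) (-((n + 1 : ℕ) : ℚ))
    rw [show -((n + 1 : ℕ) : ℚ) + 1 = -n by push_cast; ring, hodd.neg_pow] at e2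
    rw [Nat.sub_add_cancel hpr.one_le,
      show (p * t + (n + 1 : ℕ) : ℚ) - 1 = p * t + n by push_cast; ring] at e1
    rw [← e1] at c2
    refine (RatCong.of_eq ?_).trans
      (((c1.add c2).sub (RatCong.refl (4 * t * (t + 1) * (p * ((n + 1 : ℕ) : ℚ) ^ (p - 2))))).trans
        (RatCong.of_eq ?_))
    · linear_combination 2 * t * (t + 1) * p * e2
    · rw [pow_succ, Nat.succ_eq_add_one]
      ring

theorem sum_hypTerm_ratCong (hp : Odd p) {a t ε c : ℚ} {n : ℕ} (ht : t ∈ padicIntegralRat p)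
    (hn : n < p) (hat : a = p * t + n) (ha0 : 2 * a + 1 ≠ 0)
    (ha : (2 * a + 1)⁻¹ ∈ padicIntegralRat p) (hε : (-1) ^ n * (1 + 2 * t) = ε * (2 * a + 1))
    (hc : -2 * t * (t + 1) = c * (2 * a + 1)) :
    RatCong p 2 (∑ k ∈ range p, hypTerm a k)
      (ε + c * p * (eulerPolynomial (p - 2)).eval (-a)) := by
  have c1 := hypSum_add_eval_eulerPolynomial_ratCong hp ht hn
  -- The Euler value is multiplied by p, so moving its argument from -n to -a modulo p suffices.
  have cE : RatCong p 1 ((eulerPolynomial (p - 2)).eval (-a))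
      ((eulerPolynomial (p - 2)).eval (-n : ℚ)) :=
    RatCong.eval_eulerPolynomial hp _ (neg_mem (natCast_mem _ n))
      ⟨-t, neg_mem ht, by rw [hat]; ring⟩
  have c2 := cE.prime_mul.mul_left
    (mul_mem (mul_mem (ofNat_mem _ 2) ht) (add_mem ht (one_mem _)))
  have c3 := ((c1.sub (RatCong.refl (2 * t * (t + 1) *
    (p * (eulerPolynomial (p - 2)).eval (-n : ℚ))))).trans
      ((RatCong.refl _).sub c2.symm)).mul_left ha
  refine (RatCong.of_eq ?_).trans (c3.trans (RatCong.of_eq ?_))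
  · rw [← hat, hypSum]
    field_simp
    ring
  · rw [hε]
    have : 2 * t * (t + 1) = -(c * (2 * a + 1)) := by linear_combination -hc
    rw [this]
    field_simp
    ring

theorem padicCongr_sum_hypTerm (hp : Odd p) {a t ε c : ℚ} {n : ℕ} (ht : t ∈ padicIntegralRat p)
    (hn : n < p) (hat : a = p * t + n) (ha0 : 2 * a + 1 ≠ 0)
    (ha : (2 * a + 1)⁻¹ ∈ padicIntegralRat p) (hε : (-1) ^ n * (1 + 2 * t) = ε * (2 * a + 1))
    (hc : -2 * t * (t + 1) = c * (2 * a + 1)) :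
    PadicCongr p 2 (∑ k ∈ range p, hypTerm a k)
      (ε + c * p * (eulerPolynomial (p - 2)).eval (-a)) := by
  have ham : a ∈ padicIntegralRat p := by
    rw [hat]
    exact add_mem (mul_mem (natCast_mem _ p) ht) (natCast_mem _ n)
  have hεm : ε ∈ padicIntegralRat p := by
    rw [show ε = (-1) ^ n * (1 + 2 * t) * (2 * a + 1)⁻¹ by rw [hε]; field_simp]
    exact mul_mem (mul_mem (pow_mem (neg_mem (one_mem _)) _)
      (add_mem (one_mem _) (mul_mem (ofNat_mem _ 2) ht))) ha
  have hcm : c ∈ padicIntegralRat p := by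
    rw [show c = -2 * t * (t + 1) * (2 * a + 1)⁻¹ by rw [hc]; field_simp]
    exact mul_mem (mul_mem (mul_mem (neg_mem (ofNat_mem _ 2)) ht) (add_mem ht (one_mem _))) ha
  refine PadicCongr.of_ratCong ?_ (sum_hypTerm_ratCong hp ht hn hat ha0 ha hε hc)
  exact add_mem hεm (mul_mem (mul_mem hcm (natCast_mem _ p))
      (eval_eulerPolynomial_mem_padicIntegralRat hp _ (neg_mem ham)))

theorem hypTerm_neg_one_quarter (k : ℕ) :
    hypTerm (-1 / 4) k = ((4 * k).choose (2 * k) : ℚ) / ((2 * k + 1) * 16 ^ k) := by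
  have hch : ∀ k : ℕ, ((4 * k).choose (2 * k) : ℚ) =
      ((4 * k).factorial : ℚ) / ((2 * k).factorial * (2 * k).factorial) := fun k => by
    rw [Nat.cast_choose ℚ (by omega), show 4 * k - 2 * k = 2 * k by omega]
  induction k with
  | zero => simp [hypTerm]
  | succ k ih =>
    have h2 : ((2 * k).factorial : ℚ) ≠ 0 := by exact_mod_cast Nat.factorial_ne_zero _
    have h3 : (k : ℚ) * 2 + 3 ≠ 0 := by positivity
    rw [hypTerm_succ, ih, hch, hch, show 4 * (k + 1) = 4 * k + 1 + 1 + 1 + 1 by ring,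
      show 2 * (k + 1) = 2 * k + 1 + 1 by ring]
    simp only [Nat.factorial_succ]
    push_cast
    field_simp
    ring

theorem hypTerm_neg_one_third (k : ℕ) :
    hypTerm (-1 / 3) k = ((3 * k).choose k : ℚ) / (2 * k + 1) * (4 / 27) ^ k := by
  have hch : ∀ k : ℕ, ((3 * k).choose k : ℚ) =
      ((3 * k).factorial : ℚ) / (k.factorial * (2 * k).factorial) := fun k => by
    rw [Nat.cast_choose ℚ (by omega), show 3 * k - k = 2 * k by omega]
  induction k with
  | zero => simp [hypTerm]
  | succ k ih =>
    have h2 : ((2 * k).factorial : ℚ) ≠ 0 := by exact_mod_cast Nat.factorial_ne_zero _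
    have h1 : (k.factorial : ℚ) ≠ 0 := by exact_mod_cast Nat.factorial_ne_zero _
    have h3 : (k : ℚ) * 2 + 3 ≠ 0 := by positivity
    rw [hypTerm_succ, ih, hch, hch, show 3 * (k + 1) = 3 * k + 1 + 1 + 1 by ring,
      show 2 * (k + 1) = 2 * k + 1 + 1 by ring, pow_succ]
    simp only [Nat.factorial_succ]
    push_cast
    field_simp
    ring

theorem hypTerm_neg_one_sixth (k : ℕ) :
    hypTerm (-1 / 6) k = ((6 * k).choose (3 * k) : ℚ) * ((3 * k).choose k : ℚ) /
      ((2 * k + 1) * 108 ^ k * ((2 * k).choose k : ℚ)) := by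
  have hch : ∀ k : ℕ, ((6 * k).choose (3 * k) : ℚ) * ((3 * k).choose k : ℚ) /
      ((2 * k + 1) * 108 ^ k * ((2 * k).choose k : ℚ)) =
      ((6 * k).factorial : ℚ) * k.factorial /
        ((2 * k + 1) * 108 ^ k * ((3 * k).factorial * (2 * k).factorial * (2 * k).factorial)) := by
    intro k
    have h3 : ((3 * k).factorial : ℚ) ≠ 0 := by exact_mod_cast Nat.factorial_ne_zero _
    have h2 : ((2 * k).factorial : ℚ) ≠ 0 := by exact_mod_cast Nat.factorial_ne_zero _
    have h1 : (k.factorial : ℚ) ≠ 0 := by exact_mod_cast Nat.factorial_ne_zero _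
    rw [Nat.cast_choose ℚ (show 3 * k ≤ 6 * k by omega), Nat.cast_choose ℚ (show k ≤ 3 * k by omega),
      Nat.cast_choose ℚ (show k ≤ 2 * k by omega), show 6 * k - 3 * k = 3 * k by omega,
      show 3 * k - k = 2 * k by omega, show 2 * k - k = k by omega]
    field_simp
  rw [hch]
  induction k with
  | zero => simp [hypTerm]
  | succ k ih =>
    have h3 : ((3 * k).factorial : ℚ) ≠ 0 := by exact_mod_cast Nat.factorial_ne_zero _
    have h2 : ((2 * k).factorial : ℚ) ≠ 0 := by exact_mod_cast Nat.factorial_ne_zero _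
    have h4 : (k : ℚ) * 2 + 3 ≠ 0 := by positivity
    rw [hypTerm_succ, ih, show 6 * (k + 1) = 6 * k + 1 + 1 + 1 + 1 + 1 + 1 by ring,
      show 3 * (k + 1) = 3 * k + 1 + 1 + 1 by ring,
      show 2 * (k + 1) = 2 * k + 1 + 1 by ring, pow_succ]
    simp only [Nat.factorial_succ]
    push_cast
    field_simp
    ring

theorem legendreSym_three (hp : Odd p) (h3 : p ≠ 3) :
    legendreSym p 3 = if p % 12 = 1 ∨ p % 12 = 11 then 1 else -1 := by
  have hpr : p.Prime := Fact.out
  have hnd : ¬ 3 ∣ p := fun h => h3 ((Nat.prime_dvd_prime_iff_eq Nat.prime_three hpr).1 h).symm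
  have hp2 : p ≠ 2 := by rintro rfl; exact absurd hp (by decide)
  have h := legendreSym.quadratic_reciprocity' (p := 3) (q := p) (by norm_num) hp2
  rw [legendreSym.mod 3 (p : ℤ)] at h
  push_cast at h
  rw [h]
  have hr : p % 12 = 1 ∨ p % 12 = 5 ∨ p % 12 = 7 ∨ p % 12 = 11 := by
    have := Nat.odd_iff.1 hp
    omega
  have l1 : legendreSym 3 1 = 1 := by decide
  have l2 : legendreSym 3 2 = -1 := by decide
  rcases hr with hr | hr | hr | hr
  · rw [show (p : ℤ) % 3 = 1 by omega, l1, Even.neg_one_pow ⟨p / 4, by omega⟩]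
    simp [hr]
  · rw [show (p : ℤ) % 3 = 2 by omega, l2, Even.neg_one_pow ⟨p / 4, by omega⟩]
    simp [hr]
  · rw [show (p : ℤ) % 3 = 1 by omega, l1, Odd.neg_one_pow ⟨p / 4, by omega⟩]
    simp [hr]
  · rw [show (p : ℤ) % 3 = 2 by omega, l2, Odd.neg_one_pow ⟨p / 4, by omega⟩]
    simp [hr]

theorem inv_three_mem_padicIntegralRat (h3 : p ≠ 3) : (3 : ℚ)⁻¹ ∈ padicIntegralRat p := by
  exact_mod_cast inv_natCast_mem_padicIntegralRat (p := p) (n := 3)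
    fun h => h3 ((Nat.prime_dvd_prime_iff_eq Fact.out Nat.prime_three).1 h)

theorem padicCongr_sum_choose_four_mul (hp : Odd p) :
    PadicCongr p 2
      (∑ k ∈ range p, ((4 * k).choose (2 * k) : ℚ) / ((2 * (k : ℚ) + 1) * 16 ^ k))
      ((legendreSym p 2 : ℚ) +
        3 / 4 * (p : ℚ) * (eulerPolynomial (p - 2)).eval (1 / 4 : ℚ)) := by
  have hp2 : p ≠ 2 := by rintro rfl; exact absurd hp (by decide)
  have h2 := inv_two_mem_padicIntegralRat hp
  simp only [← hypTerm_neg_one_quarter]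
  rw [show (1 / 4 : ℚ) = -(-1 / 4) by norm_num, legendreSym.at_two hp2,
    ZMod.χ₈_nat_eq_if_mod_eight]
  have hinv : (2 * (-1 / 4 : ℚ) + 1)⁻¹ ∈ padicIntegralRat p := by
    rw [show (2 * (-1 / 4 : ℚ) + 1)⁻¹ = 2 by norm_num]
    exact ofNat_mem _ 2
  have ht1 : (-1 / 4 : ℚ) ∈ padicIntegralRat p := by
    rw [show (-1 / 4 : ℚ) = -(2⁻¹ * 2⁻¹) by norm_num]
    exact neg_mem (mul_mem h2 h2)
  have ht3 : (-3 / 4 : ℚ) ∈ padicIntegralRat p := by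
    rw [show (-3 / 4 : ℚ) = 3 * (-1 / 4) by norm_num]
    exact mul_mem (ofNat_mem _ 3) ht1
  have hr : p % 8 = 1 ∨ p % 8 = 3 ∨ p % 8 = 5 ∨ p % 8 = 7 := by
    have := Nat.odd_iff.1 hp
    omega
  have hdiv := Nat.div_add_mod p 8
  have hodd := Nat.odd_iff.1 hp
  -- Here n is the residue of -1/4 modulo p, and t is -1/4 or -3/4 as p ≡ 1 or 3 modulo 4. The swap
  -- t ↦ -1 - t preserves t(t + 1), hence the constant 3/4, and flips 1 + 2t. That sign and the
  -- parity of n give the Legendre symbol.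
  rcases hr with hr | hr | hr | hr
  · have hpq : (p : ℚ) = 8 * (p / 8 : ℕ) + 1 := by rw [hr] at hdiv; exact_mod_cast hdiv.symm
    refine padicCongr_sum_hypTerm hp (n := 2 * (p / 8)) ht1 (by omega) ?_ (by norm_num) hinv ?_
      (by norm_num)
    · rw [hpq]; push_cast; ring
    · rw [Even.neg_one_pow ⟨p / 8, by omega⟩]
      simp [hr, hodd]; norm_num
  · have hpq : (p : ℚ) = 8 * (p / 8 : ℕ) + 3 := by rw [hr] at hdiv; exact_mod_cast hdiv.symm
    refine padicCongr_sum_hypTerm hp (n := 6 * (p / 8) + 2) ht3 (by omega) ?_ (by norm_num) hinv ?_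
      (by norm_num)
    · rw [hpq]; push_cast; ring
    · rw [Even.neg_one_pow ⟨3 * (p / 8) + 1, by omega⟩]
      simp [hr, hodd]; norm_num
  · have hpq : (p : ℚ) = 8 * (p / 8 : ℕ) + 5 := by rw [hr] at hdiv; exact_mod_cast hdiv.symm
    refine padicCongr_sum_hypTerm hp (n := 2 * (p / 8) + 1) ht1 (by omega) ?_ (by norm_num) hinv ?_
      (by norm_num)
    · rw [hpq]; push_cast; ring
    · rw [Odd.neg_one_pow ⟨p / 8, by omega⟩]
      simp [hr, hodd]; norm_num
  · have hpq : (p : ℚ) = 8 * (p / 8 : ℕ) + 7 := by rw [hr] at hdiv; exact_mod_cast hdiv.symm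
    refine padicCongr_sum_hypTerm hp (n := 6 * (p / 8) + 5) ht3 (by omega) ?_ (by norm_num) hinv ?_
      (by norm_num)
    · rw [hpq]; push_cast; ring
    · rw [Odd.neg_one_pow ⟨3 * (p / 8) + 2, by omega⟩]
      simp [hr, hodd]; norm_num

theorem padicCongr_sum_choose_three_mul (hp : Odd p) (h3 : p ≠ 3) :
    PadicCongr p 2
      (∑ k ∈ range p, ((3 * k).choose k : ℚ) / (2 * (k : ℚ) + 1) * (4 / 27 : ℚ) ^ k)
      (1 + 4 / 3 * (p : ℚ) * (eulerPolynomial (p - 2)).eval (1 / 3 : ℚ)) := by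
  have hpr : p.Prime := Fact.out
  have hnd : ¬ 3 ∣ p := fun h => h3 ((Nat.prime_dvd_prime_iff_eq Nat.prime_three hpr).1 h).symm
  simp only [← hypTerm_neg_one_third]
  rw [show (1 / 3 : ℚ) = -(-1 / 3) by norm_num]
  have hinv : (2 * (-1 / 3 : ℚ) + 1)⁻¹ ∈ padicIntegralRat p := by
    rw [show (2 * (-1 / 3 : ℚ) + 1)⁻¹ = 3 by norm_num]
    exact ofNat_mem _ 3
  have ht1 : (-1 / 3 : ℚ) ∈ padicIntegralRat p := by
    rw [show (-1 / 3 : ℚ) = -3⁻¹ by norm_num]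
    exact neg_mem (inv_three_mem_padicIntegralRat h3)
  have ht2 : (-2 / 3 : ℚ) ∈ padicIntegralRat p := by
    rw [show (-2 / 3 : ℚ) = 2 * (-1 / 3) by norm_num]
    exact mul_mem (ofNat_mem _ 2) ht1
  have hdiv := Nat.div_add_mod p 6
  have hodd := Nat.odd_iff.1 hp
  -- The parity of n and the sign of 1 + 2t change together, so ε = 1 in both cases.
  rcases (show p % 6 = 1 ∨ p % 6 = 5 by omega) with hr | hr
  · have hpq : (p : ℚ) = 6 * (p / 6 : ℕ) + 1 := by rw [hr] at hdiv; exact_mod_cast hdiv.symm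
    refine padicCongr_sum_hypTerm hp (n := 2 * (p / 6)) ht1 (by omega) ?_ (by norm_num) hinv ?_
      (by norm_num)
    · rw [hpq]; push_cast; ring
    · rw [Even.neg_one_pow ⟨p / 6, by omega⟩]
      norm_num
  · have hpq : (p : ℚ) = 6 * (p / 6 : ℕ) + 5 := by rw [hr] at hdiv; exact_mod_cast hdiv.symm
    refine padicCongr_sum_hypTerm hp (n := 4 * (p / 6) + 3) ht2 (by omega) ?_ (by norm_num) hinv ?_
      (by norm_num)
    · rw [hpq]; push_cast; ring
    · rw [Odd.neg_one_pow ⟨2 * (p / 6) + 1, by omega⟩]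
      norm_num

theorem padicCongr_sum_choose_six_mul (hp : Odd p) (h3 : p ≠ 3) :
    PadicCongr p 2
      (∑ k ∈ range p, ((6 * k).choose (3 * k) : ℚ) * ((3 * k).choose k : ℚ) /
        ((2 * (k : ℚ) + 1) * 108 ^ k * ((2 * k).choose k : ℚ)))
      ((legendreSym p 3 : ℚ) +
        5 / 12 * (p : ℚ) * (eulerPolynomial (p - 2)).eval (1 / 6 : ℚ)) := by
  have hpr : p.Prime := Fact.out
  have hnd : ¬ 3 ∣ p := fun h => h3 ((Nat.prime_dvd_prime_iff_eq Nat.prime_three hpr).1 h).symm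
  have h2m := inv_two_mem_padicIntegralRat hp
  simp only [← hypTerm_neg_one_sixth]
  rw [show (1 / 6 : ℚ) = -(-1 / 6) by norm_num, legendreSym_three hp h3]
  have hinv : (2 * (-1 / 6 : ℚ) + 1)⁻¹ ∈ padicIntegralRat p := by
    rw [show (2 * (-1 / 6 : ℚ) + 1)⁻¹ = 3 * 2⁻¹ by norm_num]
    exact mul_mem (ofNat_mem _ 3) h2m
  have ht1 : (-1 / 6 : ℚ) ∈ padicIntegralRat p := by
    rw [show (-1 / 6 : ℚ) = -(3⁻¹ * 2⁻¹) by norm_num]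
    exact neg_mem (mul_mem (inv_three_mem_padicIntegralRat h3) h2m)
  have ht5 : (-5 / 6 : ℚ) ∈ padicIntegralRat p := by
    rw [show (-5 / 6 : ℚ) = 5 * (-1 / 6) by norm_num]
    exact mul_mem (ofNat_mem _ 5) ht1
  have hdiv := Nat.div_add_mod p 12
  have hodd := Nat.odd_iff.1 hp
  -- The class of p modulo 6 decides between t = -1/6 and -5/6; modulo 12 it also fixes the parity
  -- of n.
  rcases (show p % 12 = 1 ∨ p % 12 = 5 ∨ p % 12 = 7 ∨ p % 12 = 11 by omega) with hr | hr | hr | hr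
  · have hpq : (p : ℚ) = 12 * (p / 12 : ℕ) + 1 := by rw [hr] at hdiv; exact_mod_cast hdiv.symm
    refine padicCongr_sum_hypTerm hp (n := 2 * (p / 12)) ht1 (by omega) ?_ (by norm_num) hinv ?_
      (by norm_num)
    · rw [hpq]; push_cast; ring
    · rw [Even.neg_one_pow ⟨p / 12, by omega⟩]
      simp [hr]; norm_num
  · have hpq : (p : ℚ) = 12 * (p / 12 : ℕ) + 5 := by rw [hr] at hdiv; exact_mod_cast hdiv.symm
    refine padicCongr_sum_hypTerm hp (n := 10 * (p / 12) + 4) ht5 (by omega) ?_ (by norm_num) hinv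
      ?_ (by norm_num)
    · rw [hpq]; push_cast; ring
    · rw [Even.neg_one_pow ⟨5 * (p / 12) + 2, by omega⟩]
      simp [hr]; norm_num
  · have hpq : (p : ℚ) = 12 * (p / 12 : ℕ) + 7 := by rw [hr] at hdiv; exact_mod_cast hdiv.symm
    refine padicCongr_sum_hypTerm hp (n := 2 * (p / 12) + 1) ht1 (by omega) ?_ (by norm_num) hinv
      ?_ (by norm_num)
    · rw [hpq]; push_cast; ring
    · rw [Odd.neg_one_pow ⟨p / 12, by omega⟩]
      simp [hr]; norm_num
  · have hpq : (p : ℚ) = 12 * (p / 12 : ℕ) + 11 := by rw [hr] at hdiv; exact_mod_cast hdiv.symm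
    refine padicCongr_sum_hypTerm hp (n := 10 * (p / 12) + 9) ht5 (by omega) ?_ (by norm_num) hinv
      ?_ (by norm_num)
    · rw [hpq]; push_cast; ring
    · rw [Odd.neg_one_pow ⟨5 * (p / 12) + 4, by omega⟩]
      simp [hr]; norm_num

end Main

end

theorem corollary1p1 (p : ℕ) [Fact p.Prime] (hp : Odd p) :
    PadicCongr p 2
      (∑ k ∈ Finset.range p,
        (Nat.choose (4 * k) (2 * k) : ℚ) / ((2 * (k : ℚ) + 1) * 16 ^ k))
      ((legendreSym p 2 : ℚ) +
        3 / 4 * (p : ℚ) * (eulerPolynomial (p - 2)).eval (1 / 4 : ℚ)) ∧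
    (3 < p →
      PadicCongr p 2
        (∑ k ∈ Finset.range p,
          (Nat.choose (3 * k) k : ℚ) / (2 * (k : ℚ) + 1) * (4 / 27 : ℚ) ^ k)
        (1 + 4 / 3 * (p : ℚ) * (eulerPolynomial (p - 2)).eval (1 / 3 : ℚ)) ∧
      PadicCongr p 2
        (∑ k ∈ Finset.range p,
          (Nat.choose (6 * k) (3 * k) : ℚ) * (Nat.choose (3 * k) k : ℚ) /
            ((2 * (k : ℚ) + 1) * 108 ^ k * (Nat.choose (2 * k) k : ℚ)))
        ((legendreSym p 3 : ℚ) +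
          5 / 12 * (p : ℚ) * (eulerPolynomial (p - 2)).eval (1 / 6 : ℚ))) := by
  exact ⟨padicCongr_sum_choose_four_mul hp, fun h3 =>
    ⟨padicCongr_sum_choose_three_mul hp h3.ne', padicCongr_sum_choose_six_mul hp h3.ne'⟩⟩
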